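/- A function between topological spaces is Baire-one if it is a pointwise limit of a sequence of continuous functions, and Lebesgue-one if the preimage of every closed set is a $G_\delta$-set. A subset $E$ of a topological space $X$ is a $B_1$-retract (respectively, an $H_1$-retract) of $X$ if there is a Baire-one (respectively, Lebesgue-one) function $r:X\to E$, where $E$ carries the subspace topology, such that $r(x)=x$ for all $x\in E$. Let $(q_n)_{n\ge 1}$ be any enumeration (possibly with repetitions) of $\mathbb Q\cap[0,1]$, that is, $\{q_n:n\ge 1\}=\mathbb Q\cap[0,1]$. For $x\in[0,1]$ let $f_n(x)=\sin\frac1{x-q_n}$ if $x\ne q_n$ and $f_n(q_n)=0$, and put $$f(x)=\sum_{n=1}^\infty \frac1{2^n}f_n(x),\qquad X=[0,1]\times[-1,1],\qquad E=\{(x,y)\in X: y=f(x)\}.$$ Then the series converges and $f(x)\in[-1,1]$ for every $x\in[0,1]$ (so $E$ is the whole graph of $f$), $X$ is a complete separable connected and locally connected metric space, and $E$ is a connected $H_1$-retract of $X$ which is not a $B_1$-retract of $X$. -/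

import Mathlib

open Set Filter Topology

namespace RetractExample

/-- A function between topological spaces is Baire-one if it is the pointwise limit of a sequence
of continuous functions (between the same two spaces). -/
def BaireOne {X Y : Type*} [TopologicalSpace X] [TopologicalSpace Y] (f : X → Y) : Prop :=
  ∃ F : ℕ → X → Y, (∀ n, Continuous (F n)) ∧ ∀ x, Tendsto (fun n => F n x) atTop (𝓝 (f x))

/-- A function between topological spaces is Lebesgue-one if the preimage of every closed set is
a Gδ set. -/
def LebesgueOne {X Y : Type*} [TopologicalSpace X] [TopologicalSpace Y] (f : X → Y) : Prop :=
  ∀ F : Set Y, IsClosed F → IsGδ (f ⁻¹' F)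

/-- `E` is a `B₁`-retract of `X`: there is a Baire-one function `r : X → E`, where `E` carries the
subspace topology, that fixes the points of `E`. -/
def IsB1Retract {X : Type*} [TopologicalSpace X] (E : Set X) : Prop :=
  ∃ r : X → E, BaireOne r ∧ ∀ x : E, r (x : X) = x

/-- `E` is an `H₁`-retract of `X`: there is a Lebesgue-one function `r : X → E`, where `E` carries
the subspace topology, that fixes the points of `E`. -/
def IsH1Retract {X : Type*} [TopologicalSpace X] (E : Set X) : Prop :=
  ∃ r : X → E, LebesgueOne r ∧ ∀ x : E, r (x : X) = x

/-- The function `x ↦ sin (1 / (x - a))`, with value `0` at `x = a`. -/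
noncomputable def sinInv (a x : ℝ) : ℝ :=
  if x = a then 0 else Real.sin (1 / (x - a))

/-- The terms of the series at `x`. The index starts at `0`, so the weights
`1/2, 1/4, 1/8, …` are `1 / 2 ^ (n + 1)`. -/
noncomputable def term (q : ℕ → ℚ) (x : ℝ) (n : ℕ) : ℝ :=
  1 / 2 ^ (n + 1) * sinInv (q n : ℝ) x

/-- The sum of the series. -/
noncomputable def sumFun (q : ℕ → ℚ) (x : ℝ) : ℝ :=
  ∑' n, term q x n

/-- The rectangle `[0,1] × [-1,1]`. -/
abbrev Rect : Type := Icc (0 : ℝ) 1 × Icc (-1 : ℝ) 1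

/-- The graph of `sumFun q` over `[0,1]`, as a subset of the rectangle. -/
def graph (q : ℕ → ℚ) : Set Rect :=
  {p | (p.2 : ℝ) = sumFun q (p.1 : ℝ)}

end RetractExample

/-! Write `f` for `sumFun q`. By dominated convergence `f` is continuous off the countable set of
the `q n`, so `(x, y) ↦ (x, f x)` is a Lebesgue-one retraction. Each value `f x` is a limit of `f`
from either side, along points where the sine singular at `x` vanishes; with a continuity point on
every closed set this makes the graph connected. Along points where that sine is `1`, `f` tends to a
strictly larger value (`sumFun_lt_jump`), so no compact part of the graph projects onto a
nondegenerate interval. Hence continuous maps from the rectangle to the graph are constant, and so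
are their pointwise limits. -/

namespace RetractExample

/-! ### Connectedness from bilateral cluster values -/

section Connected

variable {α Y : Type*} [ConditionallyCompleteLinearOrder α] [TopologicalSpace α] [OrderTopology α]
  [TopologicalSpace Y]

theorem exists_last_mem {P : Set α} {x z : α} (hxz : x < z) (hx : x ∈ P) (hz : z ∉ P) :
    ∃ k ∈ Icc x z, (k ∈ P ∧ k < z ∧ ∀ y ∈ Ioo k z, y ∉ P) ∨ (k ∉ P ∧ k ∈ closure P) := by
  have hne : (P ∩ Icc x z).Nonempty := ⟨x, hx, le_rfl, hxz.le⟩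
  have hb : BddAbove (P ∩ Icc x z) := ⟨z, fun y hy => hy.2.2⟩
  have hxk : x ≤ sSup (P ∩ Icc x z) := le_csSup hb ⟨hx, le_rfl, hxz.le⟩
  have hkz : sSup (P ∩ Icc x z) ≤ z := csSup_le hne fun y hy => hy.2.2
  refine ⟨sSup (P ∩ Icc x z), ⟨hxk, hkz⟩, ?_⟩
  by_cases hk : sSup (P ∩ Icc x z) ∈ P
  · refine Or.inl ⟨hk, lt_of_le_of_ne hkz fun h => hz (h ▸ hk), fun y hy hyP => ?_⟩
    exact absurd (le_csSup hb ⟨hyP, hxk.trans hy.1.le, hy.2.le⟩) (not_le.2 hy.1)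
  · exact Or.inr ⟨hk, closure_mono inter_subset_left (csSup_mem_closure hne hb)⟩

theorem exists_first_mem {P : Set α} {x z : α} (hxz : z < x) (hx : x ∈ P) (hz : z ∉ P) :
    ∃ k ∈ Icc z x, (k ∈ P ∧ z < k ∧ ∀ y ∈ Ioo z k, y ∉ P) ∨ (k ∉ P ∧ k ∈ closure P) := by
  obtain ⟨k, hk, h⟩ := exists_last_mem (α := αᵒᵈ) (P := P) (x := x) (z := z) hxz hx hz
  refine ⟨k, ⟨hk.2, hk.1⟩, h.imp (fun h => ⟨h.1, h.2.1, fun y hy => h.2.2 y ⟨hy.2, hy.1⟩⟩) id⟩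

/-- A boundary point of the preimage of an open set, lying in that preimage, is not a continuity
point of the restriction to the boundary, for maps whose values are bilateral cluster values. -/
theorem not_continuousWithinAt_frontier {G : α → Y}
    (hr : ∀ x z, x < z → G x ∈ closure (G '' Ioo x z))
    (hl : ∀ x z, z < x → G x ∈ closure (G '' Ioo z x))
    {U : Set Y} (hU : IsOpen U) {x : α} (hxU : G x ∈ U) (hx : x ∈ frontier (G ⁻¹' U)) :
    ¬ ContinuousWithinAt G (frontier (G ⁻¹' U)) x := by
  intro hc
  have hW := hc (hU.mem_nhds hxU)
  rw [mem_map, mem_nhdsWithin_iff_exists_mem_nhds_inter] at hW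
  obtain ⟨W, hW, hWK⟩ := hW
  obtain ⟨b, c, hxbc, hbc, hsub⟩ := exists_Icc_mem_subset_of_mem_nhds hW
  rw [frontier_eq_closure_inter_closure] at hx
  obtain ⟨z, hzb, hzU⟩ := mem_closure_iff_nhds.1 hx.2 _ hbc
  -- Continuity along the frontier keeps it inside the preimage near `x`.
  have key : ∀ k ∈ Icc b c, k ∉ G ⁻¹' U → k ∉ closure (G ⁻¹' U) := fun k hk hkP hkc =>
    hkP (hWK ⟨hsub hk, by
      rw [frontier_eq_closure_inter_closure]; exact ⟨hkc, subset_closure hkP⟩⟩)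
  have hne : x ≠ z := fun h => hzU (h ▸ hxU)
  rcases hne.lt_or_gt with h | h
  -- The supremum `k` of the preimage in `[x, z]` either belongs to it, against clustering from the
  -- right, or is a frontier point outside it, against `key`.
  · obtain ⟨k, hk, ⟨hkP, hkz, hy⟩ | ⟨h1, h2⟩⟩ := exists_last_mem h hxU hzU
    · obtain ⟨_, hyU, y, hyI, rfl⟩ := mem_closure_iff.1 (hr k z hkz) U hU hkP
      exact hy y hyI hyU
    · exact key k ⟨hxbc.1.trans hk.1, hk.2.trans hzb.2⟩ h1 h2
  · obtain ⟨k, hk, ⟨hkP, hkz, hy⟩ | ⟨h1, h2⟩⟩ := exists_first_mem h hxU hzU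
    · obtain ⟨_, hyU, y, hyI, rfl⟩ := mem_closure_iff.1 (hl k z hkz) U hU hkP
      exact hy y hyI hyU
    · exact key k ⟨hzb.1.trans hk.1, hk.2.trans hxbc.2⟩ h1 h2

theorem isPreconnected_range_of_cluster [DenselyOrdered α] {G : α → Y}
    (hr : ∀ x z, x < z → G x ∈ closure (G '' Ioo x z))
    (hl : ∀ x z, z < x → G x ∈ closure (G '' Ioo z x))
    (hc : ∀ K : Set α, IsClosed K → K.Nonempty → ∃ x ∈ K, ContinuousWithinAt G K x) :
    IsPreconnected (range G) := by
  rintro U V hU hV hUV ⟨_, ⟨a, rfl⟩, ha⟩ ⟨_, ⟨b, rfl⟩, hb⟩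
  by_contra hcon
  have hdisj : ∀ x, G x ∈ U → G x ∉ V := fun x h1 h2 => hcon ⟨G x, mem_range_self x, h1, h2⟩
  have hcov : ∀ x, G x ∈ U ∨ G x ∈ V := fun x => hUV (mem_range_self x)
  have hcompl : (G ⁻¹' U)ᶜ = G ⁻¹' V := by
    ext x
    exact ⟨fun h => (hcov x).resolve_left h, fun h h' => hdisj x h' h⟩
  have hfr : frontier (G ⁻¹' U) = frontier (G ⁻¹' V) := by rw [← hcompl, frontier_compl]
  have hne : (frontier (G ⁻¹' U)).Nonempty :=
    nonempty_frontier_iff.2 ⟨⟨a, ha⟩, fun h => hdisj b (h ▸ mem_univ b : b ∈ G ⁻¹' U) hb⟩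
  obtain ⟨x, hx, hxc⟩ := hc _ isClosed_frontier hne
  rcases hcov x with h | h
  · exact not_continuousWithinAt_frontier hr hl hU h hx hxc
  · rw [hfr] at hx hxc
    exact not_continuousWithinAt_frontier hr hl hV h hx hxc

end Connected

/-! ### Maps with countably many discontinuities -/

/-- On a completely metrizable space, a map continuous off a countable set has a continuity point
relative to every nonempty closed set. -/
theorem exists_continuousWithinAt_of_countable {X Y : Type*} [MetricSpace X] [CompleteSpace X]
    [TopologicalSpace Y] {G : X → Y} {D : Set X} (hD : D.Countable)
    (hG : ∀ x ∉ D, ContinuousAt G x) {K : Set X} (hK : IsClosed K) (hne : K.Nonempty) :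
    ∃ x ∈ K, ContinuousWithinAt G K x := by
  by_cases h : K ⊆ D
  · have : Countable K := (hD.mono h).to_subtype
    have : CompleteSpace K := hK.completeSpace_coe
    have : Nonempty K := hne.to_subtype
    -- Baire category: a countable complete space has an isolated point, where continuity is
    -- automatic.
    obtain ⟨x, hx⟩ := nonempty_interior_of_iUnion_of_closed (f := fun x : K => {x})
      (fun _ => isClosed_singleton) (by ext; simp)
    have ho : IsOpen ({x} : Set K) := by
      obtain ⟨y, hy⟩ := hx
      obtain rfl : y = x := mem_singleton_iff.1 (interior_subset hy)
      exact isOpen_iff_mem_nhds.2 fun z hz => by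
        rw [mem_singleton_iff.1 hz]; exact mem_interior_iff_mem_nhds.1 hy
    refine ⟨x, x.2, ?_⟩
    rw [continuousWithinAt_iff_continuousAt_domRestrict _ x.2, ContinuousAt,
      (isOpen_singleton_iff_nhds_eq_pure x).1 ho]
    exact tendsto_pure_nhds _ _
  · obtain ⟨x, hxK, hx⟩ := not_subset.1 h
    exact ⟨x, hxK, (hG x hx).continuousWithinAt⟩

/-- The preimage of a closed set is a closed set with a countable subset of `D` removed. -/
theorem lebesgueOne_of_countable {X Y : Type*} [MetricSpace X]
    [TopologicalSpace Y] {G : X → Y} {D : Set X} (hD : D.Countable)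
    (hG : ∀ x ∉ D, ContinuousAt G x) : LebesgueOne G := by
  intro F hF
  have h : G ⁻¹' F = (interior (G ⁻¹' Fᶜ))ᶜ ∩ (D \ G ⁻¹' F)ᶜ := by
    ext x
    constructor
    · exact fun hx => ⟨fun h => interior_subset h hx, fun h => h.2 hx⟩
    · rintro ⟨h1, h2⟩
      by_contra hx
      have hxD : x ∉ D := fun h => h2 ⟨h, hx⟩
      exact h1 (mem_interior_iff_mem_nhds.2 (hG x hxD (hF.isOpen_compl.mem_nhds hx)))
  rw [h]
  exact isOpen_interior.isClosed_compl.isGδ.inter (hD.mono sdiff_subset).isGδ_compl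

theorem locallyConnectedSpace_Icc {a b : ℝ} (h : a ≤ b) : LocallyConnectedSpace (Icc a b) := by
  have : Fact (a ≤ b) := ⟨h⟩
  refine locallyConnectedSpace_of_connected_bases (fun x ε => Metric.ball x ε) (fun _ ε => 0 < ε)
    (fun x => Metric.nhds_basis_ball) fun x ε _ => ?_
  have : OrdConnected (Metric.ball (x : ℝ) ε) := by rw [Real.ball_eq_Ioo]; infer_instance
  exact (this.preimage_mono (f := Subtype.val) (Subtype.mono_coe _)).isPreconnected

/-! ### One-sided limits of the series -/

theorem abs_sinInv_le (a x : ℝ) : |sinInv a x| ≤ 1 := by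
  unfold sinInv
  split_ifs
  · simp
  · exact Real.abs_sin_le_one _

theorem norm_term_le (q : ℕ → ℚ) (x : ℝ) (n : ℕ) : ‖term q x n‖ ≤ 1 / 2 / 2 ^ n := by
  rw [term, Real.norm_eq_abs, abs_mul, abs_of_pos (by positivity)]
  calc _ ≤ 1 / 2 ^ (n + 1) * (1 : ℝ) := by gcongr; exact abs_sinInv_le _ _
    _ = _ := by rw [pow_succ]; field_simp

theorem summable_term (q : ℕ → ℚ) (x : ℝ) : Summable (term q x) :=
  .of_norm_bounded (summable_geometric_two' 1) (norm_term_le q x)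

theorem sumFun_mem_Icc (q : ℕ → ℚ) (x : ℝ) : sumFun q x ∈ Icc (-1 : ℝ) 1 := by
  refine abs_le.1 ?_
  exact tsum_of_norm_bounded (hasSum_geometric_two' 1) (norm_term_le q x)

theorem tendsto_sumFun {ι : Type*} {l : Filter ι} {q : ℕ → ℚ} {u : ι → ℝ} {a : ℕ → ℝ}
    (h : ∀ n, Tendsto (fun i => term q (u i) n) l (𝓝 (a n))) :
    Tendsto (fun i => sumFun q (u i)) l (𝓝 (∑' n, a n)) :=
  tendsto_tsum_of_dominated_convergence (summable_geometric_two' 1) h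
    (.of_forall fun i n => norm_term_le q (u i) n)

theorem continuousAt_term {q : ℕ → ℚ} {x : ℝ} {n : ℕ} (h : x ≠ q n) :
    ContinuousAt (fun y => term q y n) x := by
  have : ContinuousAt (fun y => 1 / 2 ^ (n + 1) * Real.sin (1 / (y - q n))) x :=
    continuousAt_const.mul (Real.continuous_sin.continuousAt.comp
      (continuousAt_const.div (by fun_prop) (sub_ne_zero.2 h)))
  refine this.congr ?_
  filter_upwards [isOpen_ne.mem_nhds h] with y hy
  rw [term, sinInv, if_neg hy]

theorem continuousAt_sumFun {q : ℕ → ℚ} {x : ℝ} (h : ∀ n, x ≠ q n) :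
    ContinuousAt (sumFun q) x :=
  tendsto_sumFun fun n => continuousAt_term (h n)

/-- Since `θ k` is the reciprocal of the displacement from `x`, every term singular at `x` has sine
exactly `s`, so repetitions in `q` do no harm. -/
theorem tendsto_sumFun_add_inv (q : ℕ → ℚ) (x s : ℝ) {θ : ℕ → ℝ} (h0 : ∀ k, θ k ≠ 0)
    (hθ : Tendsto (fun k => x + (θ k)⁻¹) atTop (𝓝 x)) (hs : ∀ k, Real.sin (θ k) = s) :
    Tendsto (fun k => sumFun q (x + (θ k)⁻¹)) atTop
      (𝓝 (∑' n, if x = q n then 1 / 2 ^ (n + 1) * s else term q x n)) := by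
  refine tendsto_sumFun fun n => ?_
  split_ifs with h
  · refine tendsto_const_nhds.congr fun k => ?_
    rw [term, sinInv, ← h, if_neg (by simpa using h0 k)]
    simp [hs]
  · exact (continuousAt_term h).tendsto.comp hθ

theorem tendsto_sumFun_add_inv_zero (q : ℕ → ℚ) (x : ℝ) {θ : ℕ → ℝ} (h0 : ∀ k, θ k ≠ 0)
    (hθ : Tendsto (fun k => x + (θ k)⁻¹) atTop (𝓝 x)) (hs : ∀ k, Real.sin (θ k) = 0) :
    Tendsto (fun k => sumFun q (x + (θ k)⁻¹)) atTop (𝓝 (sumFun q x)) := by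
  convert tendsto_sumFun_add_inv q x 0 h0 hθ hs using 3
  refine tsum_congr fun n => ?_
  split_ifs with h
  · simp [term, sinInv, h]
  · rfl

theorem sumFun_lt_jump {q : ℕ → ℚ} {x : ℝ} {m : ℕ} (hm : x = q m) :
    sumFun q x < ∑' n, if x = q n then 1 / 2 ^ (n + 1) * (1 : ℝ) else term q x n := by
  have hle : ∀ n, term q x n ≤ if x = q n then 1 / 2 ^ (n + 1) * (1 : ℝ) else term q x n := by
    intro n
    split_ifs with h
    · simp [term, sinInv, h]
    · rfl
  refine (summable_term q x).tsum_lt_tsum (i := m) hle ?_ ?_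
  · rw [if_pos hm]
    simp [term, sinInv, hm]
  · refine .of_norm_bounded (summable_geometric_two' 1) fun n => ?_
    split_ifs with h
    · rw [Real.norm_of_nonneg (by positivity), pow_succ]
      apply le_of_eq
      field_simp
    · exact norm_term_le q x n

/-! ### The graph: connectedness and retractions -/

/-- The parametrization of the graph. -/
noncomputable def graphMap (q : ℕ → ℚ) (x : Icc (0 : ℝ) 1) : Rect :=
  (x, ⟨sumFun q x, sumFun_mem_Icc q x⟩)

theorem range_graphMap (q : ℕ → ℚ) : range (graphMap q) = graph q := by
  ext ⟨x, y⟩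
  constructor
  · rintro ⟨z, hz⟩
    rw [← hz]
    rfl
  · intro h
    exact ⟨x, Prod.ext rfl (Subtype.ext h.symm)⟩

theorem tendsto_graphMap {ι : Type*} {l : Filter ι} {q : ℕ → ℚ} {u : ι → Icc (0 : ℝ) 1}
    {x : Icc (0 : ℝ) 1} (hu : Tendsto (fun i => (u i : ℝ)) l (𝓝 x))
    (h : Tendsto (fun i => sumFun q (u i)) l (𝓝 (sumFun q x))) :
    Tendsto (fun i => graphMap q (u i)) l (𝓝 (graphMap q x)) :=
  (tendsto_subtype_rng.2 hu).prodMk_nhds (tendsto_subtype_rng.2 h)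

theorem continuousAt_graphMap {q : ℕ → ℚ} {x : Icc (0 : ℝ) 1} (h : ∀ n, (x : ℝ) ≠ q n) :
    ContinuousAt (graphMap q) x :=
  tendsto_graphMap continuousAt_subtype_val
    ((continuousAt_sumFun h).comp (f := Subtype.val) continuousAt_subtype_val)

theorem countable_bad (q : ℕ → ℚ) : {x : Icc (0 : ℝ) 1 | ∃ n, (x : ℝ) = q n}.Countable := by
  refine ((countable_range fun n => (q n : ℝ)).preimage Subtype.val_injective).mono ?_
  rintro x ⟨n, hn⟩
  exact ⟨n, hn.symm⟩

theorem tendsto_add_inv (x : ℝ) {θ : ℕ → ℝ} (h : Tendsto θ atTop atTop) :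
    Tendsto (fun k => x + (θ k)⁻¹) atTop (𝓝 x) := by
  simpa using tendsto_const_nhds.add (tendsto_inv_atTop_zero.comp h) (a := x)

/-- Zeros of the sine; the shift `k + 1` avoids the angle `0`, which has no reciprocal. -/
theorem tendsto_nat_mul_pi : Tendsto (fun k : ℕ => ((k + 1 : ℕ) : ℝ) * Real.pi) atTop atTop :=
  ((tendsto_natCast_atTop_atTop (R := ℝ)).comp (tendsto_add_atTop_nat 1)).atTop_mul_const
    Real.pi_pos

theorem graphMap_mem_closure {q : ℕ → ℚ} {x : Icc (0 : ℝ) 1} {s : Set (Icc (0 : ℝ) 1)}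
    {θ : ℕ → ℝ} (h0 : ∀ k, θ k ≠ 0) (hθ : Tendsto (fun k => (x : ℝ) + (θ k)⁻¹) atTop (𝓝 x))
    (hs : ∀ k, Real.sin (θ k) = 0)
    (h : ∀ᶠ k in atTop, (x : ℝ) + (θ k)⁻¹ ∈ Subtype.val '' s) :
    graphMap q x ∈ closure (graphMap q '' s) := by
  obtain ⟨N, hN⟩ := eventually_atTop.1 h
  choose u hus hu using fun k : ℕ => hN (k + N) (Nat.le_add_left N k)
  refine mem_closure_of_tendsto (f := fun k => graphMap q (u k)) (b := atTop)
    (tendsto_graphMap ?_ ?_) (.of_forall fun k => mem_image_of_mem _ (hus k))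
  · simp_rw [hu]
    exact hθ.comp (tendsto_add_atTop_nat N)
  · simp_rw [hu]
    exact (tendsto_sumFun_add_inv_zero q x h0 hθ hs).comp (tendsto_add_atTop_nat N)

theorem isConnected_graph (q : ℕ → ℚ) : IsConnected (graph q) := by
  rw [← range_graphMap]
  have hpos : ∀ k : ℕ, 0 < ((k + 1 : ℕ) : ℝ) * Real.pi := fun k => by positivity
  refine ⟨range_nonempty _, isPreconnected_range_of_cluster (fun x z hxz => ?_)
    (fun x z hxz => ?_) fun K hK hne => exists_continuousWithinAt_of_countable
      (countable_bad q) (fun x hx => continuousAt_graphMap fun n hn => hx ⟨n, hn⟩) hK hne⟩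
  · have ht := tendsto_add_inv x tendsto_nat_mul_pi
    refine graphMap_mem_closure (fun k => (hpos k).ne') ht (fun k => Real.sin_nat_mul_pi _) ?_
    filter_upwards [ht.eventually_lt_const (show (x : ℝ) < z from hxz)] with k hk
    have := inv_pos.2 (hpos k)
    exact ⟨⟨_, by linarith [x.2.1], by linarith [z.2.2]⟩,
      ⟨show (x : ℝ) < _ by linarith, hk⟩, rfl⟩
  · have ht : Tendsto (fun k : ℕ => (x : ℝ) + (-(((k + 1 : ℕ) : ℝ) * Real.pi))⁻¹) atTop (𝓝 x) := by
      simpa [inv_neg, ← sub_eq_add_neg] using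
        tendsto_const_nhds.sub (tendsto_inv_atTop_zero.comp tendsto_nat_mul_pi) (a := (x : ℝ))
    refine graphMap_mem_closure (fun k => neg_ne_zero.2 (hpos k).ne') ht
      (fun k => by rw [Real.sin_neg, Real.sin_nat_mul_pi, neg_zero]) ?_
    filter_upwards [ht.eventually_const_lt (show (z : ℝ) < x from hxz)] with k hk
    have := inv_pos.2 (hpos k)
    rw [inv_neg] at hk ⊢
    exact ⟨⟨_, by linarith [z.2.1], by linarith [x.2.2]⟩,
      ⟨hk, show _ < (x : ℝ) by linarith⟩, rfl⟩

theorem isH1Retract_graph (q : ℕ → ℚ) : IsH1Retract (graph q) := by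
  refine ⟨fun p => ⟨graphMap q p.1, range_graphMap q ▸ mem_range_self p.1⟩, fun F hF => ?_, ?_⟩
  · obtain ⟨C, hC, rfl⟩ := isClosed_induced_iff.1 hF
    have h : IsGδ (graphMap q ⁻¹' C) := lebesgueOne_of_countable (countable_bad q)
      (fun x hx => continuousAt_graphMap fun n hn => hx ⟨n, hn⟩) C hC
    exact h.preimage (f := Prod.fst) continuous_fst
  · rintro ⟨p, hp⟩
    exact Subtype.ext (Prod.ext rfl (Subtype.ext hp.symm))

/-- A compact subset of the graph in the plane does not project onto a nondegenerate interval. -/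
theorem not_Icc_subset_fst_image {q : ℕ → ℚ} (hq : range q = Icc 0 1) {K : Set (ℝ × ℝ)}
    (hK : IsClosed K) (hKg : ∀ p ∈ K, p.2 = sumFun q p.1) {a b : ℝ} (ha : 0 ≤ a) (hab : a < b)
    (hb : b ≤ 1) : ¬ Icc a b ⊆ Prod.fst '' K := by
  intro hsub
  obtain ⟨r, har, hrb⟩ := exists_rat_btwn hab
  have hr : r ∈ range q := by
    rw [hq]
    exact ⟨by exact_mod_cast ha.trans har.le, by exact_mod_cast hrb.le.trans hb⟩
  obtain ⟨m, hm⟩ := hr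
  -- At these angles the sine is `1`, and `r + (θ k)⁻¹` decreases to `r`.
  have hθ : Tendsto (fun k : ℕ => Real.pi / 2 + (k : ℝ) * (2 * Real.pi)) atTop atTop :=
    tendsto_atTop_add_const_left _ _
      (tendsto_natCast_atTop_atTop.atTop_mul_const Real.two_pi_pos)
  have hpos : ∀ k : ℕ, 0 < Real.pi / 2 + (k : ℝ) * (2 * Real.pi) := fun k => by positivity
  have ht := tendsto_add_inv (r : ℝ) hθ
  have hlim := ht.prodMk_nhds (tendsto_sumFun_add_inv q r 1 (fun k => (hpos k).ne') ht
    fun k => by rw [Real.sin_add_nat_mul_two_pi, Real.sin_pi_div_two])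
  -- The closed set `K` would contain the limit point, which lies strictly above the graph at `r`.
  have hmem := hK.mem_of_tendsto hlim ?_
  · exact (sumFun_lt_jump (q := q) (x := r) (m := m) (by rw [hm])).ne' (hKg _ hmem)
  · filter_upwards [ht.eventually_lt_const hrb] with k hk
    have := inv_pos.2 (hpos k)
    obtain ⟨p, hp, hpx⟩ := hsub ⟨by linarith, hk.le⟩
    rwa [← hpx, ← hKg p hp]

/-- The image of `g` is compact and its projection is an interval, which must therefore be a single
point. -/
theorem eq_of_continuous_of_graph {q : ℕ → ℚ} (hq : range q = Icc 0 1) {X : Type*}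
    [TopologicalSpace X] [CompactSpace X] [PreconnectedSpace X] {g : X → graph q}
    (hg : Continuous g) (x y : X) : g x = g y := by
  have hfst : Continuous fun z => ((g z : Rect).1 : ℝ) := by fun_prop
  have hsnd : Continuous fun z => ((g z : Rect).2 : ℝ) := by fun_prop
  have hno : ∀ x y, ¬ ((g x : Rect).1 : ℝ) < (g y : Rect).1 := by
    intro x y hxy
    refine not_Icc_subset_fst_image hq (isCompact_range (hfst.prodMk hsnd)).isClosed ?_
      (g x : Rect).1.2.1 hxy (g y : Rect).1.2.2 ?_
    · rintro _ ⟨z, rfl⟩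
      exact (g z).2
    · rw [← range_comp]
      exact (isPreconnected_range hfst).Icc_subset ⟨x, rfl⟩ ⟨y, rfl⟩
  have h : ((g x : Rect).1 : ℝ) = (g y : Rect).1 :=
    le_antisymm (not_lt.1 (hno y x)) (not_lt.1 (hno x y))
  refine Subtype.ext (Prod.ext (Subtype.ext h) (Subtype.ext ?_))
  exact ((g x).2.trans (congrArg _ h)).trans (g y).2.symm

theorem not_isB1Retract_graph {q : ℕ → ℚ} (hq : range q = Icc 0 1) :
    ¬ IsB1Retract (graph q) := by
  have : PreconnectedSpace (Icc (0 : ℝ) 1) := Subtype.preconnectedSpace isPreconnected_Icc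
  have : PreconnectedSpace (Icc (-1 : ℝ) 1) := Subtype.preconnectedSpace isPreconnected_Icc
  rintro ⟨r, ⟨F, hF, hr⟩, hid⟩
  have hmem : ∀ x, graphMap q x ∈ graph q := fun x => range_graphMap q ▸ mem_range_self x
  -- Each `F n` is constant, so `r` identifies two graph points that it should fix.
  have h : r (graphMap q 0) = r (graphMap q 1) :=
    tendsto_nhds_unique (hr _)
      ((hr _).congr fun n => eq_of_continuous_of_graph hq (hF n) _ _)
  have h' := hid ⟨_, hmem 0⟩
  rw [h, hid ⟨_, hmem 1⟩] at h'
  have := congrArg (fun p : graph q => ((p : Rect).1 : ℝ)) h'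
  simp [graphMap] at this

end RetractExample

theorem mainTheorem3 (q : ℕ → ℚ) (hq : Set.range q = Set.Icc (0 : ℚ) 1) :
    (∀ x ∈ Set.Icc (0 : ℝ) 1,
      Summable (RetractExample.term q x) ∧ RetractExample.sumFun q x ∈ Set.Icc (-1 : ℝ) 1) ∧
    CompleteSpace RetractExample.Rect ∧
    TopologicalSpace.SeparableSpace RetractExample.Rect ∧
    ConnectedSpace RetractExample.Rect ∧
    LocallyConnectedSpace RetractExample.Rect ∧
    IsConnected (RetractExample.graph q) ∧
    RetractExample.IsH1Retract (RetractExample.graph q) ∧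
    ¬ RetractExample.IsB1Retract (RetractExample.graph q) := by
  have : ConnectedSpace (Icc (0 : ℝ) 1) := Subtype.connectedSpace (isConnected_Icc (by norm_num))
  have : ConnectedSpace (Icc (-1 : ℝ) 1) := Subtype.connectedSpace (isConnected_Icc (by norm_num))
  have := RetractExample.locallyConnectedSpace_Icc (zero_le_one (α := ℝ))
  have := RetractExample.locallyConnectedSpace_Icc (show (-1 : ℝ) ≤ 1 by norm_num)
  exact ⟨fun x _ => ⟨RetractExample.summable_term q x, RetractExample.sumFun_mem_Icc q x⟩,
    inferInstance, inferInstance, inferInstance, inferInstance,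
    RetractExample.isConnected_graph q, RetractExample.isH1Retract_graph q,
    RetractExample.not_isB1Retract_graph hq⟩
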